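/- Let $K$ be a field of characteristic zero, $d\ge 0$ an integer, $\underline{x}=(x_1,\dots,x_d)$, and let $K[[\underline{x}^{1/\mathbf N}]]=\bigcup_{k\ge 1}K[[x_1^{1/k},\dots,x_d^{1/k}]]$ be the ring of fractional power series. A Weierstrass polynomial is a monic polynomial in $K[[\underline{x}]][y]$ all of whose coefficients other than the leading one are non-units of $K[[\underline{x}]]$ (the constant polynomial $1$ is allowed). Let $f,g\in K[[\underline{x}]][y]$ be Weierstrass polynomials and write $$\mathrm{Res}_y\bigl(g(y),\,f(y)-T\bigr)=c_0T^m+c_1T^{m-1}+\cdots+c_m\in K[[\underline{x}]][T],\qquad m=\deg g,\quad c_0=\pm 1 .$$ Assume that there is $\mathbf q\in\mathbf Q^d$ such that $$c_i\,K[[\underline{x}^{1/\mathbf N}]]\subseteq \underline{x}^{i\mathbf q}\,K[[\underline{x}^{1/\mathbf N}]]\qquad\text{for all }1\le i\le m,$$ with equality for some $i=i_0$ with $1\le i_0<m$, and with strict inclusion for $i=m$. Then $g$ is not irreducible in the ring $K[[\underline{x}]][y]$. -/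

import Mathlib

open Polynomial

noncomputable section

namespace WeierstrassNewton

/-- A Weierstrass polynomial over `K[[x_1, …, x_d]]`: a monic polynomial all of whose
coefficients other than the leading one are non-units. (The constant polynomial `1` is allowed.) -/
def IsWeierstrass {d : ℕ} {K : Type*} [Field K] (g : (MvPowerSeries (Fin d) K)[X]) : Prop :=
  g.Monic ∧ ∀ j < g.natDegree, ¬ IsUnit (g.coeff j)

/-- The ring `K[[x_1^{1/ℕ}, …, x_d^{1/ℕ}]]` of fractional power series, i.e. the union over `k ≥ 1`
of the rings `K[[x_1^{1/k}, …, x_d^{1/k}]]`: formal series whose exponents all lie in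
`((1/k) ℕ)^d` for a common `k ≥ 1`. It is realised inside the ring of Hahn series with exponents in
`ℚ^d`, in which `x^q` makes sense for every `q ∈ ℚ^d`. -/
def fracPowerSeries (d : ℕ) (K : Type*) [Field K] : Subring (HahnSeries (Fin d → ℚ) K) where
  carrier := {α | ∃ k : ℕ, 0 < k ∧ ∀ e ∈ α.support, ∀ j, ∃ n : ℕ, e j = (n : ℚ) / k}
  zero_mem' := ⟨1, one_pos, by simp⟩
  one_mem' := ⟨1, one_pos, by
    intro e he j
    rw [HahnSeries.support_one, Set.mem_singleton_iff] at he
    exact ⟨0, by simp [he]⟩⟩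
  neg_mem' := by
    rintro α ⟨k, hk, h⟩
    exact ⟨k, hk, by simpa only [HahnSeries.support_neg] using h⟩
  add_mem' := by
    rintro α β ⟨k, hk, h⟩ ⟨l, hl, h'⟩
    have hk' : (k : ℚ) ≠ 0 := by positivity
    have hl' : (l : ℚ) ≠ 0 := by positivity
    refine ⟨k * l, Nat.mul_pos hk hl, fun e he j => ?_⟩
    rcases HahnSeries.support_add_subset α β he with he | he
    · obtain ⟨n, hn⟩ := h e he j
      exact ⟨n * l, by rw [hn]; push_cast; field_simp⟩
    · obtain ⟨n, hn⟩ := h' e he j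
      exact ⟨n * k, by rw [hn]; push_cast; field_simp⟩
  mul_mem' := by
    rintro α β ⟨k, hk, h⟩ ⟨l, hl, h'⟩
    have hk' : (k : ℚ) ≠ 0 := by positivity
    have hl' : (l : ℚ) ≠ 0 := by positivity
    refine ⟨k * l, Nat.mul_pos hk hl, fun e he j => ?_⟩
    obtain ⟨a, ha, b, hb, rfl⟩ := Set.mem_add.mp (HahnSeries.support_mul_subset he)
    obtain ⟨n, hn⟩ := h a ha j
    obtain ⟨p, hp⟩ := h' b hb j
    exact ⟨n * l + p * k, by rw [Pi.add_apply, hn, hp]; push_cast; field_simp⟩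

/-- The inclusion of exponents `ℕ^d ⊆ ℚ^d`. -/
def exponentHom (d : ℕ) : (Fin d →₀ ℕ) →+ (Fin d → ℚ) where
  toFun n j := n j
  map_zero' := by ext; simp
  map_add' _ _ := by ext; simp

theorem exponentHom_injective (d : ℕ) : Function.Injective (exponentHom d) := by
  intro a b h
  ext j
  have hj : ((a j : ℕ) : ℚ) = b j := congrFun h j
  exact_mod_cast hj

theorem exponentHom_le_iff (d : ℕ) (a b : Fin d →₀ ℕ) :
    exponentHom d a ≤ exponentHom d b ↔ a ≤ b := by
  simp [exponentHom, Pi.le_def, Finsupp.le_def]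

/-- The inclusion of `K[[x_1, …, x_d]]` into the ring of Hahn series with exponents in `ℚ^d`. -/
def ofPowerSeries (d : ℕ) (K : Type*) [Field K] :
    MvPowerSeries (Fin d) K →+* HahnSeries (Fin d → ℚ) K :=
  (HahnSeries.embDomainRingHom (exponentHom d) (exponentHom_injective d)
    (exponentHom_le_iff d)).comp (RingEquiv.toRingHom HahnSeries.toMvPowerSeries.symm)

/-- `K[[x]] ⊆ K[[x^{1/ℕ}]]`. -/
theorem ofPowerSeries_mem {d : ℕ} {K : Type*} [Field K] (c : MvPowerSeries (Fin d) K) :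
    ofPowerSeries d K c ∈ fracPowerSeries d K := by
  refine ⟨1, one_pos, fun e he j => ?_⟩
  obtain ⟨n, -, rfl⟩ := HahnSeries.support_embDomain_subset he
  exact ⟨n j, by simp [exponentHom]⟩

/-- The monomial `x^q` with exponent `q ∈ ℚ^d`. -/
def fracMonomial {d : ℕ} (K : Type*) [Field K] (q : Fin d → ℚ) : HahnSeries (Fin d → ℚ) K :=
  HahnSeries.single q 1

/-- `α K[[x^{1/ℕ}]] = {α w : w ∈ K[[x^{1/ℕ}]]}`. -/
def fracMultiples {d : ℕ} {K : Type*} [Field K] (α : HahnSeries (Fin d → ℚ) K) :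
    Set (HahnSeries (Fin d → ℚ) K) :=
  {β | ∃ w ∈ fracPowerSeries d K, β = α * w}

/-- The coefficient-divisibility condition on `P = c_0 T^m + c_1 T^{m-1} + ⋯ + c_m`, `m = deg P`:
there is `q ∈ ℚ^d` such that `c_i K[[x^{1/ℕ}]] ⊆ x^{iq} K[[x^{1/ℕ}]]` for `1 ≤ i ≤ m`, with
equality for some `1 ≤ i₀ < m` and with strict inclusion for `i = m`. -/
def HasSlopeCondition {d : ℕ} {K : Type*} [Field K] (P : (MvPowerSeries (Fin d) K)[X]) : Prop :=
  ∃ q : Fin d → ℚ,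
    (∀ i : ℕ, 1 ≤ i → i ≤ P.natDegree →
      fracMultiples (ofPowerSeries d K (P.coeff (P.natDegree - i))) ⊆
        fracMultiples (fracMonomial K (i • q))) ∧
    (∃ i₀ : ℕ, 1 ≤ i₀ ∧ i₀ < P.natDegree ∧
      fracMultiples (ofPowerSeries d K (P.coeff (P.natDegree - i₀))) =
        fracMultiples (fracMonomial K (i₀ • q))) ∧
    fracMultiples (ofPowerSeries d K (P.coeff 0)) ⊂
      fracMultiples (fracMonomial K (P.natDegree • q))

/-- `Res_y(g(y), f(y) - T)`, a polynomial in `T` over `A`. Inside the resultant the outer variable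
of `A[T][y]` is `y`, and `T` is the inner variable, `C X`. -/
def resultantSubT {A : Type*} [CommRing A] (g f : A[X]) : A[X] :=
  resultant (g.map (C : A →+* A[X])) (f.map (C : A →+* A[X]) - C X)

end WeierstrassNewton

end

/-!
Write `A = K⟦x⟧` and let `R` be the integral closure of `A` in an algebraic closure of its fraction
field. By Weierstrass preparation the minimal polynomial over `A` of an element of `R` either has a
unit as constant coefficient or is congruent to a power of the variable modulo the maximal ideal,
so that `R` is a local ring.

Up to sign, `c_j` is the `j`-th elementary symmetric function of the values `α = f(β)` at the roots
`β` of `g`. The slope condition implies divisibilities inside `A`: writing `i` for `i₀`,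
`c_i ^ j ∣ c_j ^ i` for all `j`, while `c_m ^ i` does not divide `c_i ^ m`. Let `ρ` be an `i`-th
root of `c_i`. The symmetric functions of the quotients `α / ρ` are integral, so these quotients lie
in `R`. Their `i`-th symmetric function is a unit, so one of them is a unit because `R` is local;
their product is not a unit since `A` is integrally closed, so another one is not. If `g` were
irreducible, it would stay so over the fraction field of `A` by Gauss's lemma, and an automorphism
would carry the first `β` to the second, hence the unit `α ^ i / c_i` to the corresponding
non-unit.

That `A` is integrally closed is proved one variable at a time. The property that passes from a
domain to its power series ring is complete integral closedness: an almost integral power series is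
determined coefficient by coefficient, the lowest coefficient being almost integral itself.
-/

open scoped PowerSeries

namespace WeierstrassNewton

/-- Complete integral closedness: every element `a / b` of the fraction field that is almost
integral over `R` lies in `R`. Unlike integral closedness, this passes from `R` to `R⟦X⟧` without
a Noetherian hypothesis. The formulation by divisibility does not mention the fraction field. -/
def IsCompletelyIntegrallyClosed (R : Type*) [CommRing R] : Prop :=
  ∀ ⦃a b c : R⦄, b ≠ 0 → c ≠ 0 → (∀ n, b ^ n ∣ c * a ^ n) → b ∣ a

section CompletelyIntegrallyClosed

variable {R S : Type*} [CommRing R] [CommRing S]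

theorem IsCompletelyIntegrallyClosed.of_ringEquiv (hR : IsCompletelyIntegrallyClosed R)
    (e : R ≃+* S) : IsCompletelyIntegrallyClosed S := by
  intro a b c hb hc h
  rw [← map_dvd_iff e.symm]
  refine hR (c := e.symm c) (by simpa using hb) (by simpa using hc) fun n => ?_
  simpa using map_dvd e.symm (h n)

theorem isCompletelyIntegrallyClosed_iff [IsDomain R] (F : Type*) [Field F] [Algebra R F]
    [IsFractionRing R F] :
    IsCompletelyIntegrallyClosed R ↔
      ∀ x : F, IsAlmostIntegral R x → ∃ r, algebraMap R F r = x := by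
  have pow_dvd_iff {a b c : R} (hb : algebraMap R F b ≠ 0) (n : ℕ) :
      b ^ n ∣ c * a ^ n ↔
        c • (algebraMap R F a / algebraMap R F b) ^ n ∈ (algebraMap R F).range := by
    refine exists_congr fun z => ?_
    rw [← (IsFractionRing.injective R F).eq_iff, Algebra.smul_def, div_pow, mul_div_assoc',
      eq_div_iff (pow_ne_zero n hb), eq_comm]
    simp only [map_mul, map_pow, mul_comm]
  constructor
  · intro hR x ⟨c, hc, hca⟩
    obtain ⟨a, b, hb, rfl⟩ := IsFractionRing.div_surjective (A := R) x
    have hb0 : algebraMap R F b ≠ 0 := IsFractionRing.to_map_ne_zero_of_mem_nonZeroDivisors hb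
    obtain ⟨y, rfl⟩ : b ∣ a := hR (nonZeroDivisors.ne_zero hb) (nonZeroDivisors.ne_zero hc)
      fun n => (pow_dvd_iff hb0 n).2 (hca n)
    exact ⟨y, by rw [map_mul, mul_div_cancel_left₀ _ hb0]⟩
  · intro hF a b c hb hc h
    have hb0 : algebraMap R F b ≠ 0 := by simpa using hb
    obtain ⟨y, hy⟩ := hF (algebraMap R F a / algebraMap R F b)
      ⟨c, mem_nonZeroDivisors_of_ne_zero hc, fun n => (pow_dvd_iff hb0 n).1 (h n)⟩
    refine ⟨y, IsFractionRing.injective R F ?_⟩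
    rw [map_mul, hy, mul_div_cancel₀ _ hb0]

theorem IsCompletelyIntegrallyClosed.isIntegrallyClosed [IsDomain R]
    (hR : IsCompletelyIntegrallyClosed R) : IsIntegrallyClosed R :=
  (isIntegrallyClosed_iff (FractionRing R)).2 fun hx =>
    (isCompletelyIntegrallyClosed_iff (FractionRing R)).1 hR _ hx.isAlmostIntegral

theorem isCompletelyIntegrallyClosed_of_isNoetherianRing [IsDomain R] [IsNoetherianRing R]
    [IsIntegrallyClosed R] : IsCompletelyIntegrallyClosed R :=
  (isCompletelyIntegrallyClosed_iff (FractionRing R)).2 fun _ hx =>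
    IsIntegrallyClosed.isIntegral_iff.1 hx.isIntegral

section PowerSeries

variable [IsDomain R] {F : Type*} [Field F] [Algebra R F] [IsFractionRing R F]

theorem IsCompletelyIntegrallyClosed.constantCoeff_mem_range (hR : IsCompletelyIntegrallyClosed R)
    {k : ℕ} {t : F⟦X⟧} (h : IsAlmostIntegral R⟦X⟧ (PowerSeries.X ^ k * t)) :
    ∃ r, algebraMap R F r = PowerSeries.constantCoeff t := by
  obtain ⟨c, hc, hct⟩ := h
  refine (isCompletelyIntegrallyClosed_iff F).1 hR _
    ⟨PowerSeries.constantCoeff c.divXPowOrder, mem_nonZeroDivisors_of_ne_zero ?_, fun n => ?_⟩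
  · exact PowerSeries.constantCoeff_divXPowOrder_eq_zero_iff.not.2 (nonZeroDivisors.ne_zero hc)
  obtain ⟨d, hd⟩ := hct n
  refine ⟨PowerSeries.coeff (0 + (c.order.toNat + k * n)) d, ?_⟩
  have hcX : algebraMap R⟦X⟧ F⟦X⟧ c =
      PowerSeries.X ^ c.order.toNat * algebraMap R⟦X⟧ F⟦X⟧ c.divXPowOrder := by
    conv_lhs => rw [← PowerSeries.X_pow_order_mul_divXPowOrder (f := c), map_mul, map_pow]
    congr 2
    exact PowerSeries.map_X _
  calc algebraMap R F (PowerSeries.coeff (0 + (c.order.toNat + k * n)) d)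
      = PowerSeries.coeff (0 + (c.order.toNat + k * n)) (algebraMap R⟦X⟧ F⟦X⟧ d) :=
        (PowerSeries.coeff_map _ _ _).symm
    _ = PowerSeries.coeff (0 + (c.order.toNat + k * n)) (PowerSeries.X ^ (c.order.toNat + k * n) *
          (algebraMap R⟦X⟧ F⟦X⟧ c.divXPowOrder * t ^ n)) := by
        rw [hd, Algebra.smul_def, hcX, mul_pow, ← pow_mul, pow_add]
        ring_nf
    _ = PowerSeries.constantCoeff c.divXPowOrder • PowerSeries.constantCoeff t ^ n := by
        rw [PowerSeries.coeff_X_pow_mul, PowerSeries.coeff_zero_eq_constantCoeff_apply, map_mul,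
          map_pow, Algebra.smul_def]
        rfl

theorem IsCompletelyIntegrallyClosed.exists_X_pow_dvd_sub (hR : IsCompletelyIntegrallyClosed R)
    {s : F⟦X⟧} (hs : IsAlmostIntegral R⟦X⟧ s) (n : ℕ) :
    ∃ r : R⟦X⟧, PowerSeries.X ^ n ∣ s - algebraMap R⟦X⟧ F⟦X⟧ r := by
  induction n with
  | zero => exact ⟨0, by simp⟩
  | succ n ih =>
    obtain ⟨r, t, ht⟩ := ih
    obtain ⟨ρ, hρ⟩ := hR.constantCoeff_mem_range (k := n) (t := t) <| by
      rw [← ht]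
      exact sub_mem (mem_completeIntegralClosure.2 hs) (algebraMap_mem _ r)
    obtain ⟨u, hu⟩ : PowerSeries.X ∣ t - PowerSeries.C (algebraMap R F ρ) := by
      rw [PowerSeries.X_dvd_iff, map_sub, PowerSeries.constantCoeff_C, hρ, sub_self]
    refine ⟨r + PowerSeries.X ^ n * PowerSeries.C ρ, u, ?_⟩
    have hmap : algebraMap R⟦X⟧ F⟦X⟧ (PowerSeries.X ^ n * PowerSeries.C ρ) =
        PowerSeries.X ^ n * PowerSeries.C (algebraMap R F ρ) := by
      rw [map_mul, map_pow]
      exact congr_arg₂ (· ^ n * ·) (PowerSeries.map_X _) (PowerSeries.map_C _ ρ)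
    rw [map_add, hmap, ← sub_sub, ht, ← mul_sub, hu, pow_succ, mul_assoc]

theorem IsCompletelyIntegrallyClosed.mem_range_of_isAlmostIntegral
    (hR : IsCompletelyIntegrallyClosed R) {s : F⟦X⟧} (hs : IsAlmostIntegral R⟦X⟧ s) :
    ∃ r, algebraMap R⟦X⟧ F⟦X⟧ r = s := by
  choose r hr using hR.exists_X_pow_dvd_sub hs
  refine ⟨PowerSeries.mk fun n => PowerSeries.coeff n (r (n + 1)), PowerSeries.ext fun n => ?_⟩
  have hn : PowerSeries.coeff n s = algebraMap R F (PowerSeries.coeff n (r (n + 1))) :=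
    sub_eq_zero.1 (PowerSeries.X_pow_dvd_iff.1 (hr (n + 1)) n n.lt_succ_self)
  rw [hn]
  exact congrArg (algebraMap R F) (PowerSeries.coeff_mk n _)

theorem IsCompletelyIntegrallyClosed.powerSeries (hR : IsCompletelyIntegrallyClosed R) :
    IsCompletelyIntegrallyClosed R⟦X⟧ := by
  intro a b c hb hc h
  let φ := algebraMap R⟦X⟧ (FractionRing R)⟦X⟧
  have hφ : Function.Injective φ := PowerSeries.map_injective _ (IsFractionRing.injective R _)
  obtain ⟨s, hs⟩ : φ b ∣ φ a := isCompletelyIntegrallyClosed_of_isNoetherianRing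
    ((map_ne_zero_iff φ hφ).2 hb) ((map_ne_zero_iff φ hφ).2 hc) fun n => by
      simpa only [map_mul, map_pow] using map_dvd φ (h n)
  obtain ⟨y, hy⟩ := hR.mem_range_of_isAlmostIntegral (s := s)
    ⟨c, mem_nonZeroDivisors_of_ne_zero hc, fun n => by
      obtain ⟨z, hz⟩ := h n
      refine ⟨z, mul_left_cancel₀ (pow_ne_zero n ((map_ne_zero_iff φ hφ).2 hb)) ?_⟩
      rw [Algebra.smul_def, mul_left_comm, ← mul_pow, ← hs, ← map_pow, ← map_pow, ← map_mul,
        ← map_mul, hz]⟩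
  exact ⟨y, hφ (by rw [hs, map_mul, ← hy])⟩

end PowerSeries

theorem isCompletelyIntegrallyClosed_mvPowerSeries_fin [IsDomain R]
    (hR : IsCompletelyIntegrallyClosed R) (n : ℕ) :
    IsCompletelyIntegrallyClosed (MvPowerSeries (Fin n) R) := by
  induction n with
  | zero => exact hR.of_ringEquiv (MvPowerSeries.isEmptyEquiv (Fin 0) R).toRingEquiv.symm
  | succ n ih =>
    have : IsDomain (MvPowerSeries (Fin n) R) := NoZeroDivisors.to_isDomain _
    exact ih.powerSeries.of_ringEquiv (MvPowerSeries.finSuccEquiv R n).toRingEquiv.symm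

end CompletelyIntegrallyClosed

section MvPowerSeries

theorem mem_span_range_X {σ R : Type*} [Finite σ] [CommRing R]
    {f : MvPowerSeries σ R} (hf : MvPowerSeries.constantCoeff f = 0) :
    f ∈ Ideal.span (Set.range (MvPowerSeries.X : σ → MvPowerSeries σ R)) := by
  classical
  have := Fintype.ofFinite σ
  have exists_ne_zero (e : σ →₀ ℕ) (he : e ≠ 0) : ∃ i, e i ≠ 0 := Finsupp.ne_iff.1 he
  choose i hi using exists_ne_zero
  let part (j : σ) : MvPowerSeries σ R := fun e =>
    if h : e = 0 then 0 else if i e h = j then MvPowerSeries.coeff e f else 0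
  have coeff_part (j : σ) (e : σ →₀ ℕ) : MvPowerSeries.coeff e (part j) =
    if h : e = 0 then 0 else if i e h = j then MvPowerSeries.coeff e f else 0 := rfl
  have hsum : f = ∑ j, part j := by
    ext e
    simp only [map_sum, coeff_part]
    split_ifs with h
    · rw [h, Finset.sum_const_zero]
      exact hf
    · rw [Finset.sum_ite_eq, if_pos (Finset.mem_univ _)]
  rw [hsum]
  refine sum_mem fun j _ => Ideal.mem_of_dvd _ (MvPowerSeries.X_dvd_iff.2 fun e he => ?_)
    (Ideal.subset_span ⟨j, rfl⟩)
  rw [coeff_part]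
  split_ifs with h hij
  · rfl
  · exact absurd he (hij ▸ hi e h)
  · rfl

theorem maximalIdeal_mvPowerSeries (σ K : Type*) [Finite σ] [Field K] :
    IsLocalRing.maximalIdeal (MvPowerSeries σ K) = .span (.range MvPowerSeries.X) := by
  refine le_antisymm (fun f hf => mem_span_range_X ?_) (Ideal.span_le.2 ?_)
  · by_contra h
    exact hf (MvPowerSeries.isUnit_iff_constantCoeff.2 (isUnit_iff_ne_zero.2 h))
  · rintro _ ⟨i, rfl⟩ hu
    simpa using hu.map MvPowerSeries.constantCoeff

theorem isAdicComplete_maximalIdeal_mvPowerSeries (σ K : Type*) [Finite σ] [Field K] :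
    IsAdicComplete (IsLocalRing.maximalIdeal (MvPowerSeries σ K)) (MvPowerSeries σ K) := by
  rw [maximalIdeal_mvPowerSeries]
  infer_instance

end MvPowerSeries
section Local

variable {A : Type*} [CommRing A] [IsLocalRing A] [IsAdicComplete (IsLocalRing.maximalIdeal A) A]

theorem dvd_of_coe_dvd_coe {D p : A[X]} (hD : D.IsDistinguishedAt (IsLocalRing.maximalIdeal A))
    (h : (D : A⟦X⟧) ∣ p) : D ∣ p := by
  rw [← Ideal.mem_span_singleton, ← Ideal.Quotient.eq_zero_iff_mem] at h ⊢
  refine (hD.algEquivQuotient).injective ?_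
  rw [map_zero]
  exact h

theorem isUnit_coeff_zero_or_isDistinguishedAt {p : A[X]} (hp : p.Monic) (hirr : Irreducible p) :
    IsUnit (p.coeff 0) ∨ p.IsDistinguishedAt (IsLocalRing.maximalIdeal A) := by
  have hp0 : (p : A⟦X⟧).map (IsLocalRing.residue A) ≠ 0 := by
    rw [← polynomial_map_coe, Ne, Polynomial.coe_eq_zero_iff]
    exact (hp.map (IsLocalRing.residue A)).ne_zero
  obtain ⟨D, h, H⟩ := PowerSeries.exists_isWeierstrassFactorization hp0
  have hD := H.isDistinguishedAt
  obtain ⟨r, hr⟩ := dvd_of_coe_dvd_coe hD ⟨h, H.eq_mul⟩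
  rcases hirr.isUnit_or_isUnit hr with hu | hu
  · left
    have : IsUnit (p : A⟦X⟧) := H.eq_mul ▸ (hu.map coeToPowerSeries.ringHom).mul H.isUnit
    simpa using this.map PowerSeries.constantCoeff
  · right
    rwa [eq_of_monic_of_associated hp hD.monic
      (hr ▸ (associated_mul_unit_right D r hu).symm)]

variable (A) in
theorem isLocalRing_of_isIntegral [IsDomain A] (B : Type*) [CommRing B] [IsDomain B]
    [Algebra A B] [Algebra.IsIntegral A B] : IsLocalRing B := by
  refine .of_isUnit_or_isUnit_one_sub_self fun x => ?_
  have hx : IsIntegral A x := Algebra.IsIntegral.isIntegral x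
  set μ := minpoly A x
  have isUnit_sub (a : A) (ha : IsUnit (μ.eval a)) : IsUnit (algebraMap A B a - x) := by
    refine isUnit_of_dvd_unit ?_ (ha.map (algebraMap A B))
    have := sub_dvd_eval_sub (algebraMap A B a) x (μ.map (algebraMap A B))
    rwa [eval_map_algebraMap, eval_map_algebraMap, minpoly.aeval, sub_zero,
      aeval_algebraMap_apply_eq_algebraMap_eval] at this
  rcases isUnit_coeff_zero_or_isDistinguishedAt (minpoly.monic hx) (minpoly.irreducible hx)
    with h0 | hdist
  · left
    simpa using isUnit_sub 0 (by rwa [← coeff_zero_eq_eval_zero])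
  · right
    rw [← map_one (algebraMap A B)]
    refine isUnit_sub 1 (IsLocalRing.residue_ne_zero_iff_isUnit _ |>.1 ?_)
    have hmap : μ.map (IsLocalRing.residue A) = X ^ μ.natDegree := hdist.map_eq_X_pow
    rw [← eval_one_map, hmap, eval_pow, eval_X, one_pow]
    exact one_ne_zero

end Local

section SymmetricFunctions

theorem map_multiset_esymm {R S : Type*} [CommSemiring R] [CommSemiring S] (φ : R →+* S)
    (t : Multiset R) (j : ℕ) : φ (t.esymm j) = (t.map φ).esymm j := by
  simp only [Multiset.esymm, map_multiset_sum, Multiset.powersetCard_map, Multiset.map_map,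
    Function.comp_def, map_multiset_prod]

theorem exists_isUnit_of_isUnit_esymm {R : Type*} [CommRing R] [IsLocalRing R] {t : Multiset R}
    {i : ℕ} (hi : i ≠ 0) (h : IsUnit (t.esymm i)) : ∃ γ ∈ t, IsUnit γ := by
  by_contra! hnon
  refine (IsLocalRing.mem_maximalIdeal _).1 (multiset_sum_mem _ fun x hx => ?_) h
  obtain ⟨u, hu, rfl⟩ := Multiset.mem_map.1 hx
  obtain ⟨hut, hcard⟩ := Multiset.mem_powersetCard.1 hu
  obtain ⟨γ, hγ⟩ := Multiset.exists_mem_of_ne_zero (s := u) (by rintro rfl; simp_all)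
  exact Ideal.mem_of_dvd _ (Multiset.dvd_prod hγ)
    ((IsLocalRing.mem_maximalIdeal _).2 (hnon γ (Multiset.mem_of_le hut hγ)))

theorem isIntegral_of_isIntegral_esymm {A E : Type*} [CommRing A] [CommRing E] [Algebra A E]
    {t : Multiset E} (h : ∀ j ≤ t.card, IsIntegral A (t.esymm j)) {γ : E} (hγ : γ ∈ t) :
    IsIntegral A γ := by
  nontriviality E
  have hmonic : (t.map fun γ => X - C γ).prod.Monic :=
    monic_multiset_prod_of_monic _ _ fun γ _ => monic_X_sub_C γ
  have hdeg : (t.map fun γ => X - C γ).prod.natDegree = t.card :=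
    natDegree_multiset_prod_X_sub_C_eq_card t
  refine .of_aeval_monic_of_isIntegral_coeff hmonic ?_ ?_ fun k => ?_
  · exact hdeg ▸ (Multiset.card_pos_iff_exists_mem.2 ⟨γ, hγ⟩).ne'
  · have : (t.map fun γ => X - C γ).prod.eval γ = 0 :=
      eval_eq_zero_of_dvd_of_eval_eq_zero (Multiset.dvd_prod (Multiset.mem_map_of_mem _ hγ))
        (by simp)
    rw [this]
    exact isIntegral_zero
  · rcases le_or_gt k t.card with hk | hk
    · rw [Multiset.prod_X_sub_C_coeff t hk]
      exact (isIntegral_one.neg.pow _).mul (h _ (Nat.sub_le _ _))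
    · rw [coeff_eq_zero_of_natDegree_lt (hdeg ▸ hk)]
      exact isIntegral_zero

end SymmetricFunctions

section Newton

variable {A E : Type*} [CommRing A] [Field E] [Algebra A E]

theorem dvd_of_isIntegral_div [IsDomain A] [IsIntegrallyClosed A] [FaithfulSMul A E] {a b : A}
    (hb : b ≠ 0) (h : IsIntegral A (algebraMap A E a / algebraMap A E b)) : b ∣ a := by
  let φ : FractionRing A →ₐ[A] E := IsFractionRing.liftAlgHom (g := Algebra.ofId A E)
    (FaithfulSMul.algebraMap_injective A E)
  have hφ : φ (algebraMap A _ a / algebraMap A _ b) = algebraMap A E a / algebraMap A E b := by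
    rw [map_div₀, φ.commutes, φ.commutes]
  rw [← hφ, isIntegral_algHom_iff φ φ.injective, IsIntegrallyClosed.isIntegral_iff] at h
  obtain ⟨y, hy⟩ := h
  have hb0 : algebraMap A (FractionRing A) b ≠ 0 := by simpa using hb
  exact ⟨y, IsFractionRing.injective A (FractionRing A) <| by
    rw [map_mul, hy, mul_div_cancel₀ _ hb0]⟩

theorem esymm_map_div (s : Multiset E) (ρ : E) (j : ℕ) :
    (s.map (· / ρ)).esymm j = s.esymm j / ρ ^ j := by
  have hsmul : (s.map (· / ρ)) = s.map (ρ⁻¹ • ·) :=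
    Multiset.map_congr rfl fun α _ => by rw [smul_eq_mul, inv_mul_eq_div]
  rw [hsmul, ← Multiset.pow_smul_esymm, smul_eq_mul, inv_pow, inv_mul_eq_div]

variable {s : Multiset E} {a : ℕ → A} {i : ℕ} {ρ : E}

theorem isIntegral_div_of_mem (ha : ∀ j ≤ s.card, algebraMap A E (a j) = s.esymm j) (hi : i ≠ 0)
    (hdvd : ∀ j ≤ s.card, a i ^ j ∣ a j ^ i) (hρ : ρ ^ i = algebraMap A E (a i)) (hρ0 : ρ ≠ 0)
    {α : E} (hα : α ∈ s) : IsIntegral A (α / ρ) := by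
  refine isIntegral_of_isIntegral_esymm (t := s.map (· / ρ)) (fun j hj => ?_)
    (Multiset.mem_map_of_mem _ hα)
  rw [Multiset.card_map] at hj
  obtain ⟨z, hz⟩ := hdvd j hj
  have hpow : ((s.map (· / ρ)).esymm j) ^ i = algebraMap A E z := by
    rw [esymm_map_div, ← ha j hj, div_pow, ← map_pow, hz, map_mul, map_pow, ← hρ, ← pow_mul,
      ← pow_mul, mul_comm j i, mul_div_cancel_left₀ _ (pow_ne_zero _ hρ0)]
  exact .of_pow (Nat.pos_of_ne_zero hi) (hpow ▸ isIntegral_algebraMap)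

variable [IsDomain A] [IsIntegrallyClosed A] [FaithfulSMul A E]

theorem not_isUnit_of_coe_eq_div_pow {c x : A} {k i : ℕ} (hndvd : ¬ x ^ i ∣ c ^ k)
    (hρ : ρ ^ i = algebraMap A E c) {v : integralClosure A E}
    (hv : (v : E) = algebraMap A E x / ρ ^ k) : ¬ IsUnit v := by
  rintro ⟨v, rfl⟩
  have hv0 : ((v : integralClosure A E) : E) ≠ 0 := by simp
  have hx : x ^ i ≠ 0 := by
    refine pow_ne_zero i ?_
    rintro rfl
    simp [hv] at hv0
  refine hndvd (dvd_of_isIntegral_div (E := E) hx ?_)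
  have hinv : algebraMap A E (c ^ k) / algebraMap A E (x ^ i) =
      (((v⁻¹ : (integralClosure A E)ˣ) : integralClosure A E) : E) ^ i := by
    have : (((v⁻¹ : (integralClosure A E)ˣ) : integralClosure A E) : E) = (v : E)⁻¹ :=
      eq_inv_of_mul_eq_one_left (congrArg Subtype.val v.inv_mul)
    rw [this, hv, inv_div, div_pow, map_pow, map_pow, ← hρ, ← pow_mul, ← pow_mul, mul_comm i k]
  rw [hinv]
  exact IsIntegral.pow (v⁻¹ : (integralClosure A E)ˣ).1.2 i

theorem exists_pow_eq_mul_isUnit_and_not_isUnit [IsAlgClosed E]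
    [IsLocalRing (integralClosure A E)]
    (ha : ∀ j ≤ s.card, algebraMap A E (a j) = s.esymm j) (hi : i ≠ 0)
    (his : i ≤ s.card) (hdvd : ∀ j ≤ s.card, a i ^ j ∣ a j ^ i)
    (hndvd : ¬ a s.card ^ i ∣ a i ^ s.card) :
    (∃ α ∈ s, ∃ u : integralClosure A E, IsUnit u ∧ α ^ i = algebraMap A E (a i) * u) ∧
    ∃ α ∈ s, ∃ u : integralClosure A E, ¬ IsUnit u ∧ α ^ i = algebraMap A E (a i) * u := by
  obtain ⟨ρ, hρ⟩ := IsAlgClosed.exists_pow_nat_eq (algebraMap A E (a i)) (Nat.pos_of_ne_zero hi)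
  have hρ0 : ρ ≠ 0 := by
    rintro rfl
    rw [zero_pow hi, eq_comm, map_eq_zero_iff _ (FaithfulSMul.algebraMap_injective A E)] at hρ
    exact hndvd (by rw [hρ, zero_pow (by lia)]; exact dvd_zero _)
  obtain ⟨t, ht⟩ : ∃ t : Multiset (integralClosure A E), t.map (algebraMap _ E) = s.map (· / ρ) :=
    CanLift.prf (s.map (· / ρ)) (Multiset.forall_mem_map_iff.2 fun _ =>
      isIntegral_div_of_mem ha hi hdvd hρ hρ0)
  have hcard : t.card = s.card := by simpa using congrArg Multiset.card ht
  have hesymm {j : ℕ} (hj : j ≤ s.card) :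
      ((t.esymm j : integralClosure A E) : E) = algebraMap A E (a j) / ρ ^ j := by
    rw [ha j hj, ← esymm_map_div, ← ht]
    exact map_multiset_esymm (algebraMap (integralClosure A E) E) t j
  have hpow {γ : integralClosure A E} (hγ : γ ∈ t) :
      ∃ α ∈ s, α ^ i = algebraMap A E (a i) * (γ ^ i : integralClosure A E) := by
    obtain ⟨α, hα, h⟩ := Multiset.mem_map.1 (ht ▸ Multiset.mem_map_of_mem (algebraMap _ E) hγ)
    have h' : α / ρ = γ := h
    exact ⟨α, hα, by simp [← h', ← hρ, ← mul_pow, mul_div_cancel₀ _ hρ0]⟩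
  constructor
  · have hone : t.esymm i = 1 := Subtype.ext <| by
      rw [hesymm his, ← hρ, div_self (pow_ne_zero i hρ0), OneMemClass.coe_one]
    obtain ⟨γ, hγ, hu⟩ := exists_isUnit_of_isUnit_esymm hi (hone ▸ isUnit_one)
    obtain ⟨α, hα, h⟩ := hpow hγ
    exact ⟨α, hα, γ ^ i, hu.pow i, h⟩
  · have hprod : ¬ IsUnit t.prod := by
      refine not_isUnit_of_coe_eq_div_pow hndvd hρ ?_
      rw [← hesymm le_rfl, ← hcard, Multiset.esymm, Multiset.powersetCard_self]
      simp
    obtain ⟨γ, hγ, hu⟩ : ∃ γ ∈ t, ¬ IsUnit γ := by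
      contrapose! hprod
      exact multiset_prod_mem (S := IsUnit.submonoid _) t hprod
    obtain ⟨α, hα, h⟩ := hpow hγ
    exact ⟨α, hα, γ ^ i, by rwa [isUnit_pow_iff hi], h⟩

end Newton

section Resultant

variable {A E : Type*} [CommRing A] [Field E] [IsAlgClosed E] [Algebra A E] {f g : A[X]}

theorem map_resultantSubT (hg : g.Monic) :
    (resultantSubT g f).map (algebraMap A E) =
      ((g.aroots E).map fun β => C (aeval β f) - X).prod := by
  have : Nontrivial A := (algebraMap A E).domain_nontrivial
  set ι := algebraMap A E
  have map_map_C (u : A[X]) : (u.map C).map (mapRingHom ι) = (u.map ι).map C := by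
    rw [Polynomial.map_map, Polynomial.map_map]
    exact congrArg (u.map ·) (RingHom.ext fun a => by simp)
  have map_C_sub : (f.map C - C X : A[X][X]).map (mapRingHom ι) = (f.map ι).map C - C X := by
    rw [Polynomial.map_sub, map_map_C, map_C, coe_mapRingHom, map_X]
  have hsplit : (g.map ι).Splits := IsAlgClosed.splits _
  have hdeg : ((g.map ι).map (C : E →+* E[X])).natDegree = (g.map (C : A →+* A[X])).natDegree := by
    rw [(hg.map ι).natDegree_map, hg.natDegree_map, hg.natDegree_map]
  rw [resultantSubT, ← coe_mapRingHom, ← resultant_map_map, map_map_C, map_C_sub, ← hdeg,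
    resultant_eq_prod_eval _ _ _ (by rw [← map_C_sub]; exact natDegree_map_le) (hsplit.map C),
    ((hg.map ι).map C).leadingCoeff, one_pow, one_mul,
    hsplit.roots_map_of_injective C_injective, Multiset.map_map]
  exact congrArg Multiset.prod (Multiset.map_congr rfl fun β _ => by simp [eval_map, aeval_def, ι])

theorem map_resultantSubT_eq_neg_one_pow_mul (hg : g.Monic) :
    (resultantSubT g f).map (algebraMap A E) = C ((-1) ^ (g.aroots E).card) *
      (((g.aroots E).map (aeval · f)).map fun α => X - C α).prod := by
  have hneg : ((g.aroots E).map fun β => C (aeval β f) - X) =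
      (((g.aroots E).map (aeval · f)).map fun α => X - C α).map Neg.neg := by
    simp only [Multiset.map_map, Function.comp_def, neg_sub]
  rw [map_resultantSubT hg, hneg, Multiset.prod_map_neg, Multiset.card_map, Multiset.card_map,
    C_pow, C_neg, C_1]

variable [FaithfulSMul A E]

theorem natDegree_resultantSubT (hg : g.Monic) :
    (resultantSubT g f).natDegree = ((g.aroots E).map (aeval · f)).card := by
  rw [← natDegree_map_eq_of_injective (FaithfulSMul.algebraMap_injective A E),
    map_resultantSubT_eq_neg_one_pow_mul hg, natDegree_C_mul (pow_ne_zero _ (by simp)),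
    natDegree_multiset_prod_X_sub_C_eq_card]

theorem algebraMap_coeff_resultantSubT (hg : g.Monic) {j : ℕ}
    (hj : j ≤ (resultantSubT g f).natDegree) :
    algebraMap A E ((-1) ^ ((resultantSubT g f).natDegree + j) *
      (resultantSubT g f).coeff ((resultantSubT g f).natDegree - j)) =
    ((g.aroots E).map (aeval · f)).esymm j := by
  have hdeg := natDegree_resultantSubT (E := E) (f := f) hg
  set m := (resultantSubT g f).natDegree
  rw [map_mul, ← coeff_map, map_resultantSubT_eq_neg_one_pow_mul hg, coeff_C_mul,
    Multiset.prod_X_sub_C_coeff _ (hdeg ▸ Nat.sub_le m j), ← hdeg, Nat.sub_sub_self hj,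
    ← Multiset.card_map (aeval · f), ← hdeg, ← mul_assoc, ← mul_assoc, map_pow, map_neg, map_one,
    ← pow_add, ← pow_add, Even.neg_one_pow (by grind), one_mul]

end Resultant

section Conjugation

variable {A F E : Type*} [CommRing A] [Field F] [Field E] [Algebra A F] [Algebra F E] [Algebra A E]
  [IsScalarTower A F E]

theorem exists_algEquiv_apply_eq [IsIntegrallyClosed A] [IsFractionRing A F] [Normal F E]
    {g : A[X]} (hg : g.Monic) (hirr : Irreducible g) {β β' : E} (hβ : aeval β g = 0)
    (hβ' : aeval β' g = 0) : ∃ σ : E ≃ₐ[F] E, σ β = β' := by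
  have hirrF : Irreducible (g.map (algebraMap A F)) :=
    hg.irreducible_iff_irreducible_map_fraction_map.1 hirr
  have minpoly_eq {x : E} (hx : aeval x g = 0) : g.map (algebraMap A F) = minpoly F x :=
    minpoly.eq_of_irreducible_of_monic hirrF (by rwa [aeval_map_algebraMap]) (hg.map _)
  exact isConjRoot_iff_exists_algEquiv.1 ((minpoly_eq hβ').symm.trans (minpoly_eq hβ))

theorem isUnit_iff_of_pow_eq_mul (σ : E ≃ₐ[F] E) {c : A} {α : E} (hc : algebraMap A E c ≠ 0)
    {i : ℕ} {u v : integralClosure A E} (hu : α ^ i = algebraMap A E c * u)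
    (hv : σ α ^ i = algebraMap A E c * v) : IsUnit u ↔ IsUnit v := by
  have hσ : (σ.restrictScalars A).mapIntegralClosure u = v := Subtype.ext <| by
    refine mul_left_cancel₀ hc ?_
    rw [← hv, ← map_pow, hu, map_mul, ← AlgEquiv.restrictScalars_apply A σ, AlgEquiv.commutes]
    rfl
  rw [← hσ, MulEquiv.isUnit_map]

end Conjugation

theorem neg_one_pow_mul_pow_dvd_iff {A : Type*} [CommRing A] {x y : A} {k l m n : ℕ} :
    ((-1) ^ k * x) ^ m ∣ ((-1) ^ l * y) ^ n ↔ x ^ m ∣ y ^ n := by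
  rw [mul_pow, mul_pow, ((isUnit_neg_one.pow k).pow m).mul_left_dvd,
    ((isUnit_neg_one.pow l).pow n).dvd_mul_left]

theorem not_irreducible_of_coeff_resultantSubT {A : Type*} [CommRing A] [IsDomain A]
    [IsIntegrallyClosed A] [IsLocalRing A] [IsAdicComplete (IsLocalRing.maximalIdeal A) A]
    {f g : A[X]} (hg : g.Monic) {m i : ℕ} (hm : (resultantSubT g f).natDegree = m) (hi : i ≠ 0)
    (him : i ≤ m) (hdvd : ∀ j ≤ m,
      (resultantSubT g f).coeff (m - i) ^ j ∣ (resultantSubT g f).coeff (m - j) ^ i)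
    (hndvd : ¬ (resultantSubT g f).coeff 0 ^ i ∣ (resultantSubT g f).coeff (m - i) ^ m) :
    ¬ Irreducible g := by
  intro hirr
  let E := AlgebraicClosure (FractionRing A)
  let s := (g.aroots E).map (aeval · f)
  have : FaithfulSMul A E := .trans A (FractionRing A) E
  have : IsLocalRing (integralClosure A E) := isLocalRing_of_isIntegral A (integralClosure A E)
  have hs : s.card = m := (natDegree_resultantSubT hg).symm.trans hm
  let a (j : ℕ) : A := (-1) ^ (m + j) * (resultantSubT g f).coeff (m - j)
  have ha (j : ℕ) (hj : j ≤ s.card) : algebraMap A E (a j) = s.esymm j := by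
    subst hm
    exact algebraMap_coeff_resultantSubT hg (hs ▸ hj)
  have hndvd' : ¬ a s.card ^ i ∣ a i ^ s.card := by
    rwa [neg_one_pow_mul_pow_dvd_iff, hs, Nat.sub_self]
  have hc : algebraMap A E (a i) ≠ 0 := by
    rw [Ne, map_eq_zero_iff _ (FaithfulSMul.algebraMap_injective A E)]
    intro h0
    exact hndvd' (by rw [h0, zero_pow (by lia)]; exact dvd_zero _)
  obtain ⟨⟨_, hα, u, hu, hαu⟩, ⟨_, hα', v, hv, hαv⟩⟩ :=
    exists_pow_eq_mul_isUnit_and_not_isUnit ha hi (hs ▸ him)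
      (fun j hj => neg_one_pow_mul_pow_dvd_iff.2 (hdvd j (hs ▸ hj))) hndvd'
  obtain ⟨β, hβ, rfl⟩ := Multiset.mem_map.1 hα
  obtain ⟨β', hβ', rfl⟩ := Multiset.mem_map.1 hα'
  obtain ⟨σ, rfl⟩ := exists_algEquiv_apply_eq (F := FractionRing A) hg hirr
    (mem_aroots'.1 hβ).2 (mem_aroots'.1 hβ').2
  have hσ : aeval (σ β) f = σ (aeval β f) := aeval_algHom_apply (σ.restrictScalars A) β f
  exact hv ((isUnit_iff_of_pow_eq_mul σ hc hαu (hσ ▸ hαv)).1 hu)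

section FractionalPowerSeries

variable {d : ℕ} {K : Type*} [Field K] {α β : HahnSeries (Fin d → ℚ) K}

theorem self_mem_fracMultiples (α : HahnSeries (Fin d → ℚ) K) : α ∈ fracMultiples α :=
  ⟨1, one_mem _, (mul_one α).symm⟩

theorem fracMultiples_subset_iff : fracMultiples α ⊆ fracMultiples β ↔ α ∈ fracMultiples β := by
  refine ⟨fun h => h (self_mem_fracMultiples α), ?_⟩
  rintro ⟨w, hw, rfl⟩ _ ⟨z, hz, rfl⟩
  exact ⟨w * z, mul_mem hw hz, mul_assoc _ _ _⟩

theorem pow_mem_fracMultiples_pow (h : α ∈ fracMultiples β) (n : ℕ) :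
    α ^ n ∈ fracMultiples (β ^ n) := by
  obtain ⟨w, hw, rfl⟩ := h
  exact ⟨w ^ n, pow_mem hw n, mul_pow _ _ _⟩

theorem mem_fracMultiples_of_pow_mem (hβ : IsUnit β) (h : α ∈ fracMultiples β) {n : ℕ}
    (hn : n ≠ 0) (hpow : β ^ n ∈ fracMultiples (α ^ n)) : β ∈ fracMultiples α := by
  obtain ⟨w, hw, rfl⟩ := h
  obtain ⟨z, hz, hwz⟩ := hpow
  have hone : w ^ n * z = 1 := (hβ.pow n).mul_left_cancel <| by
    rw [← mul_assoc, ← mul_pow, ← hwz, mul_one]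
  refine ⟨w ^ (n - 1) * z, mul_mem (pow_mem hw _) hz, ?_⟩
  rw [mul_assoc, ← mul_assoc w, mul_pow_sub_one hn, hone, mul_one]

theorem fracMonomial_pow (q : Fin d → ℚ) (n : ℕ) :
    fracMonomial K q ^ n = fracMonomial K (n • q) := by
  simp [fracMonomial]

theorem isUnit_fracMonomial (q : Fin d → ℚ) : IsUnit (fracMonomial K q) :=
  .of_mul_eq_one (fracMonomial K (-q)) (by simp [fracMonomial])

theorem coeff_ofPowerSeries (c : MvPowerSeries (Fin d) K) (n : Fin d →₀ ℕ) :
    (ofPowerSeries d K c).coeff (exponentHom d n) = MvPowerSeries.coeff n c :=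
  HahnSeries.embDomain_coeff (f := ⟨⟨exponentHom d, exponentHom_injective d⟩,
    exponentHom_le_iff d _ _⟩) (x := HahnSeries.toMvPowerSeries.symm c)

theorem support_ofPowerSeries_subset (c : MvPowerSeries (Fin d) K) :
    (ofPowerSeries d K c).support ⊆ Set.range (exponentHom d) :=
  HahnSeries.support_embDomain_subset.trans (Set.image_subset_range _ _)

theorem ofPowerSeries_injective : Function.Injective (ofPowerSeries d K) := fun a b h => by
  ext n
  rw [← coeff_ofPowerSeries, h, coeff_ofPowerSeries]

theorem mem_range_exponentHom_of_add_mem {e : Fin d → ℚ} (he : 0 ≤ e) {n : Fin d →₀ ℕ}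
    (h : exponentHom d n + e ∈ Set.range (exponentHom d)) : e ∈ Set.range (exponentHom d) := by
  obtain ⟨p, hp⟩ := h
  have hnp : n ≤ p := (exponentHom_le_iff d n p).1 (hp ▸ le_add_of_nonneg_right he)
  refine ⟨p - n, add_left_cancel (a := exponentHom d n) ?_⟩
  rw [← map_add, add_tsub_cancel_of_le hnp, hp]

theorem nonneg_of_mem_support {w : HahnSeries (Fin d → ℚ) K} (hw : w ∈ fracPowerSeries d K)
    {e : Fin d → ℚ} (he : e ∈ w.support) : 0 ≤ e := fun j => by
  obtain ⟨k, -, h⟩ := hw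
  obtain ⟨n, hn⟩ := h e he j
  rw [hn, Pi.zero_apply]
  positivity

theorem dvd_of_ofPowerSeries_mem_fracMultiples {a b : MvPowerSeries (Fin d) K}
    (h : ofPowerSeries d K a ∈ fracMultiples (ofPowerSeries d K b)) : b ∣ a := by
  obtain ⟨w, hw, hab⟩ := h
  let w₀ : MvPowerSeries (Fin d) K := fun n => w.coeff (exponentHom d n)
  have coeff_sub (n : Fin d →₀ ℕ) : (w - ofPowerSeries d K w₀).coeff (exponentHom d n) = 0 := by
    rw [HahnSeries.coeff_sub, coeff_ofPowerSeries]
    exact sub_self _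
  have nonneg {e : Fin d → ℚ} (he : e ∈ (w - ofPowerSeries d K w₀).support) : 0 ≤ e :=
    nonneg_of_mem_support (sub_mem hw (ofPowerSeries_mem w₀)) he
  have hsub : ofPowerSeries d K (a - b * w₀) =
      ofPowerSeries d K b * (w - ofPowerSeries d K w₀) := by
    rw [map_sub, map_mul, hab, mul_sub]
  refine ⟨w₀, sub_eq_zero.1 (MvPowerSeries.ext fun n => ?_)⟩
  rw [← coeff_ofPowerSeries, map_zero, hsub]
  by_contra hne
  obtain ⟨_, hb, e, he, hn⟩ := HahnSeries.support_mul_subset hne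
  obtain ⟨p, rfl⟩ := support_ofPowerSeries_subset b hb
  obtain ⟨r, rfl⟩ := mem_range_exponentHom_of_add_mem (nonneg he) ⟨n, hn.symm⟩
  exact he (coeff_sub r)

theorem HasSlopeCondition.exists_pow_dvd_pow {P : (MvPowerSeries (Fin d) K)[X]}
    (hP : HasSlopeCondition P) :
    ∃ i ≠ 0, i ≤ P.natDegree ∧
      (∀ j ≤ P.natDegree, P.coeff (P.natDegree - i) ^ j ∣ P.coeff (P.natDegree - j) ^ i) ∧
      ¬ P.coeff 0 ^ i ∣ P.coeff (P.natDegree - i) ^ P.natDegree := by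
  obtain ⟨q, hsub, ⟨i, hi, him, heq⟩, hlt⟩ := hP
  set m := P.natDegree
  let c (j : ℕ) := ofPowerSeries d K (P.coeff (m - j))
  have hc (j : ℕ) (hj : j ≤ m) : c j ∈ fracMultiples (fracMonomial K (j • q)) := by
    rcases j.eq_zero_or_pos with rfl | hpos
    · exact ⟨c 0, ofPowerSeries_mem _, by simp [fracMonomial]⟩
    · exact fracMultiples_subset_iff.1 (hsub j hpos hj)
  have hmon : fracMonomial K (i • q) ∈ fracMultiples (c i) := fracMultiples_subset_iff.1 heq.ge
  have monomial_pow (j : ℕ) : fracMonomial K (j • q) ^ i ∈ fracMultiples (c i ^ j) := by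
    rw [fracMonomial_pow, smul_comm, ← fracMonomial_pow]
    exact pow_mem_fracMultiples_pow hmon j
  refine ⟨i, Nat.ne_of_gt hi, him.le, fun j hj => ?_, fun hdvd => hlt.2 ?_⟩
  · refine dvd_of_ofPowerSeries_mem_fracMultiples ?_
    rw [map_pow, map_pow]
    exact fracMultiples_subset_iff.2 (monomial_pow j) (pow_mem_fracMultiples_pow (hc j hj) i)
  · refine fracMultiples_subset_iff.2 (mem_fracMultiples_of_pow_mem (isUnit_fracMonomial _)
      (fracMultiples_subset_iff.1 hlt.1) (Nat.ne_of_gt hi) ?_)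
    refine fracMultiples_subset_iff.2 ?_ (monomial_pow m)
    obtain ⟨z, hz⟩ := hdvd
    exact ⟨_, ofPowerSeries_mem z, by rw [← map_pow, ← map_pow, hz, map_mul]⟩

end FractionalPowerSeries

end WeierstrassNewton

open WeierstrassNewton in
theorem mainTheorem10_general {d : ℕ} {K : Type*} [Field K]
    (f g : Polynomial (MvPowerSeries (Fin d) K)) (hg : g.Monic)
    (hR : HasSlopeCondition (resultantSubT g f)) :
    ¬ Irreducible g := by
  have : IsDomain (MvPowerSeries (Fin d) K) := NoZeroDivisors.to_isDomain _
  have : IsIntegrallyClosed (MvPowerSeries (Fin d) K) :=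
    (isCompletelyIntegrallyClosed_mvPowerSeries_fin
      isCompletelyIntegrallyClosed_of_isNoetherianRing d).isIntegrallyClosed
  have := isAdicComplete_maximalIdeal_mvPowerSeries (Fin d) K
  obtain ⟨i, hi, him, hdvd, hndvd⟩ := hR.exists_pow_dvd_pow
  exact not_irreducible_of_coeff_resultantSubT hg rfl hi him hdvd hndvd

theorem mainTheorem10 {d : ℕ} {K : Type*} [Field K] [CharZero K]
    (f g : Polynomial (MvPowerSeries (Fin d) K))
    (hf : WeierstrassNewton.IsWeierstrass f) (hg : WeierstrassNewton.IsWeierstrass g)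
    (hR : WeierstrassNewton.HasSlopeCondition (WeierstrassNewton.resultantSubT g f)) :
    ¬ Irreducible g :=
  mainTheorem10_general f g hg.1 hR
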